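/- Let $E$ be a locally compact, second countable Hausdorff space (equivalently, a complete metric space in which bounded sets are relatively compact; "bounded" means relatively compact below), let $\mu$ be a $\sigma$-finite Borel measure on $E$, and let $L_2(E,\mu)$ be the complex Hilbert space of square integrable functions. Let $\mathscr I_{1,\mathrm{loc}}(E,\mu)$ be the space of bounded operators $K$ on $L_2(E,\mu)$ such that $\chi_BK\chi_B$ is of trace class for every bounded Borel set $B\subset E$; $K_n\to K$ in $\mathscr I_{1,\mathrm{loc}}(E,\mu)$ means that $K_n,K\in\mathscr I_{1,\mathrm{loc}}(E,\mu)$ and that $\|\chi_B(K_n-K)\chi_B\|_{1}\to0$ in trace norm for every bounded Borel set $B$. Let $\mathrm{Conf}(E)$ be the space of configurations on $E$, that is, of unordered collections of points of $E$, possibly with multiplicities, having finitely many points in each bounded set, with the vague topology (the coarsest one making $X\mapsto\sum_{x\in X}\varphi(x)$ continuous for every continuous compactly supported $\varphi$) and its Borel $\sigma$-algebra. For $K\in\mathscr I_{1,\mathrm{loc}}(E,\mu)$, the determinantal measure $\mathbb P_K$ is the Borel probability measure on $\mathrm{Conf}(E)$ such that $$\mathbb E_{\mathbb P_K}\prod_{x\in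 X}g(x)=\det\bigl(1+(g-1)K\chi_B\bigr)$$ for every bounded Borel function $g:E\to\mathbb C$ with $g-1$ supported in a bounded Borel set $B$. Let $L_n$ $(n\in\mathbb N)$ and $L$ be closed subspaces of $L_2(E,\mu)$ with orthogonal projections $\Pi_n$ and $\Pi$. Let $m\in\mathbb N$, and let $v_1^{(n)},\dots,v_m^{(n)}$ and $v_1,\dots,v_m$ be vectors of $L_2(E,\mu)$. Let $\widetilde\Pi_n$ and $\widetilde\Pi$ be the orthogonal projections onto the closed subspaces $L_n+\mathbb Cv_1^{(n)}+\dots+\mathbb Cv_m^{(n)}$ and $L+\mathbb Cv_1+\dots+\mathbb Cv_m$. Assume that 1. $\Pi_n\to\Pi$ in the strong operator topology as $n\to\infty$; 2. $v_i^{(n)}\to v_i$ in $L_2(E,\mu)$ as $n\to\infty$ for $i=1,\dots,m$; 3. $v_k\notin L+\mathbb Cv_1+\dots+\mathbb Cv_{k-1}$ for $k=1,\dots,m$. Then $\widetilde\Pi_n\to\widetilde\Pi$ in the strong operator topology as $n\to\infty$. If, additionally, $\Pi_n\to\Pi$ in $\mathscr I_{1,\mathrm{loc}}(E,\mu)$,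 then also $\widetilde\Pi_n\to\widetilde\Pi$ in $\mathscr I_{1,\mathrm{loc}}(E,\mu)$ and, consequently, the determinantal measures $\mathbb P_{\widetilde\Pi_n}$ converge to $\mathbb P_{\widetilde\Pi}$ in the weak topology of the space of finite Borel measures on $\mathrm{Conf}(E)$ as $n\to\infty$. -/

import Mathlib

open MeasureTheory Filter Topology Set
open scoped ENNReal InnerProductSpace

noncomputable section

namespace DetProc

section Operators

variable {H : Type*} [NormedAddCommGroup H] [InnerProductSpace ℂ H]

/-- The trace norm of a bounded operator `A`, with value `∞` if `A` is not of trace class: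
the supremum of `∑ᵢ |⟨fᵢ, A eᵢ⟩|` over all pairs of finite orthonormal systems of the same length.
It equals `tr |A|`, the supremum being approached for `eᵢ` in the closed range of `|A|` and
`fᵢ = U eᵢ`, where `A = U |A|` is the polar decomposition. -/
def traceNorm (A : H →L[ℂ] H) : ℝ≥0∞ :=
  ⨆ (n : ℕ) (e : Fin n → H) (f : Fin n → H) (_ : Orthonormal ℂ e) (_ : Orthonormal ℂ f),
    ∑ i, ‖⟪f i, A (e i)⟫_ℂ‖ₑ

/-- The trace class. -/
def IsTraceClass (A : H →L[ℂ] H) : Prop := traceNorm A < ∞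

open scoped Classical in
/-- `HasFredholmDet A d`: the Fredholm determinant `det (1 + A)` exists and is equal to `d`, that is,
in every orthonormal basis `b` of `H` the determinants of the finite sections `1 + A_F`, where
`A_F = (⟨b i, A (b j)⟩)_{i, j ∈ F}`, converge to `d` along the directed family of finite sets `F` of
basis vectors. For `A` of trace class the limit exists and does not depend on the basis. -/
def HasFredholmDet (A : H →L[ℂ] H) (d : ℂ) : Prop :=
  ∀ (w : Set H) (b : HilbertBasis w ℂ H),
    Tendsto
      (fun F : Finset w => (1 + Matrix.of fun i j : F => ⟪b i, A (b j)⟫_ℂ).det) atTop (𝓝 d)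

/-- The closed subspace `L + ℂ v₁ + … + ℂ vₘ`. -/
def extend [CompleteSpace H] (L : ClosedSubmodule ℂ H) {m : ℕ} (v : Fin m → H) :
    ClosedSubmodule ℂ H where
  toSubmodule := L.toSubmodule ⊔ Submodule.span ℂ (range v)
  isClosed' :=
    haveI : FiniteDimensional ℂ (Submodule.span ℂ (range v)) :=
      FiniteDimensional.span_of_finite ℂ (finite_range v)
    Submodule.isClosed_sup_finiteDimensional _ _ L.isClosed

end Operators

section LocallyTraceClass

variable {E : Type*} [TopologicalSpace E] [MeasurableSpace E]

/-- Bounded Borel sets of a locally compact second countable space: the relatively compact ones.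
(Such a space has a compatible complete metric whose bounded sets are the relatively compact
sets.) -/
def IsBoundedBorel (B : Set E) : Prop := MeasurableSet B ∧ IsCompact (closure B)

open scoped Classical in
/-- The operator of multiplication by an (essentially) bounded measurable function `f` on
`L₂(E, μ)`; it is only used for such `f` (and is `0` otherwise). -/
def mulOp (μ : Measure E) (f : E → ℂ) : Lp ℂ 2 μ →L[ℂ] Lp ℂ 2 μ :=
  if hf : MemLp f ∞ μ then
    (ContinuousLinearMap.mul ℂ ℂ).holderL μ ∞ 2 2 (hf.toLp f)
  else 0

/-- The operator of multiplication by the indicator function of `B`. -/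
def cutoff (μ : Measure E) (B : Set E) : Lp ℂ 2 μ →L[ℂ] Lp ℂ 2 μ :=
  mulOp μ (B.indicator fun _ => 1)

/-- The space of locally trace class operators: `χ_B K χ_B` is of trace class for all bounded
Borel sets `B`. -/
def IsLocTraceClass (μ : Measure E) (K : Lp ℂ 2 μ →L[ℂ] Lp ℂ 2 μ) : Prop :=
  ∀ B : Set E, IsBoundedBorel B → IsTraceClass (cutoff μ B ∘L K ∘L cutoff μ B)

/-- Convergence `Kₙ → K` in the space of locally trace class operators, whose topology is given by
the seminorms `K ↦ ‖χ_B K χ_B‖₁`, for `B` bounded Borel. -/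
def TendstoLocTraceClass (μ : Measure E) (K' : ℕ → Lp ℂ 2 μ →L[ℂ] Lp ℂ 2 μ)
    (K : Lp ℂ 2 μ →L[ℂ] Lp ℂ 2 μ) : Prop :=
  (∀ n, IsLocTraceClass μ (K' n)) ∧ IsLocTraceClass μ K ∧
    ∀ B : Set E, IsBoundedBorel B →
      Tendsto (fun n => traceNorm (cutoff μ B ∘L (K' n - K) ∘L cutoff μ B)) atTop (𝓝 0)

end LocallyTraceClass

section Configurations

/-- A configuration on `E`: a collection of particles (points of `E`), without order and possibly
with multiplicities, such that every relatively compact set contains only finitely many of them.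
It is recorded by the multiplicity of each point. -/
structure Conf (E : Type*) [TopologicalSpace E] where
  mult : E → ℕ
  finite_inter : ∀ B : Set E, IsCompact (closure B) → (B ∩ Function.support mult).Finite

variable {E : Type*} [TopologicalSpace E]

/-- The additive functional `X ↦ ∑_{x ∈ X} φ(x)` of a compactly supported function `φ`
(a finite sum). -/
def Conf.sum (φ : E → ℝ) (X : Conf E) : ℝ := ∑ᶠ x, (X.mult x : ℝ) * φ x

/-- The multiplicative functional `Ψ_g : X ↦ ∏_{x ∈ X} g(x)` of a function `g` that is equal to `1`
outside a relatively compact set (a finite product). -/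
def Conf.prod (g : E → ℂ) (X : Conf E) : ℂ := ∏ᶠ x, g x ^ X.mult x

/-- The vague topology on the space of configurations: the coarsest one for which
`X ↦ ∑_{x ∈ X} φ(x)` is continuous for all continuous compactly supported `φ`. -/
instance : TopologicalSpace (Conf E) :=
  ⨅ φ : CompactlySupportedContinuousMap E ℝ, TopologicalSpace.induced (Conf.sum φ) inferInstance

instance : MeasurableSpace (Conf E) := borel (Conf E)

instance : BorelSpace (Conf E) := ⟨rfl⟩

/-- `P` is the determinantal measure `ℙ_K` on `Conf(E)` induced by the locally trace class operator
`K` on `L₂(E, μ)`: for every bounded Borel function `g` with `g - 1` supported in a bounded Borel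
set `B`, `𝔼_P Ψ_g = det (1 + (g - 1) K χ_B)`. -/
def IsDeterminantal [MeasurableSpace E] (μ : Measure E) (K : Lp ℂ 2 μ →L[ℂ] Lp ℂ 2 μ)
    (P : ProbabilityMeasure (Conf E)) : Prop :=
  IsLocTraceClass μ K ∧
    ∀ (g : E → ℂ) (B : Set E), Measurable g → (∃ C : ℝ, ∀ x, ‖g x‖ ≤ C) →
      IsBoundedBorel B → (∀ x ∉ B, g x = 1) →
        Integrable (Conf.prod g) (P : Measure (Conf E)) ∧
          HasFredholmDet (mulOp μ (fun x => g x - 1) ∘L K ∘L cutoff μ B)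
            (∫ X, Conf.prod g X ∂(P : Measure (Conf E)))

end Configurations

end DetProc

end

/-! Adjoining one vector `v` to a closed subspace with projection `P` adds to `P` the rank-one
projection onto the line of `w = v - P v` (`starProjection_sup_span_singleton`). If `Pₙ → P`
strongly and `vₙ → v`, then `wₙ → w`. Since `v` lies outside the limit subspace, `w ≠ 0`, so the
normalised rank-one terms converge too, even in trace norm. Induction on `m` gives both operator
convergences (`tendsto_extend`).

For the measures, the characteristic function of a linear statistic `∑ φ(x)` is the expectation of
the multiplicative functional of `g = exp(iφ)`, hence a Fredholm determinant. These determinants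
converge because finite sections depend on the operator continuously in trace norm, uniformly over
the sections: Hadamard's inequality bounds them by `exp ‖T‖₁`, and the Schwarz lemma turns the bound
into an estimate for differences (`HasFredholmDet.tendsto`). As `g` is unimodular, multiplication by
it does not increase trace norms, so the cutoff seminorms control everything.

By Lévy's theorem the joint laws of finitely many linear statistics converge. The vague topology is
generated by these statistics and is second countable, so every open set is a countable union of
open cylinders, and the liminf criterion on open sets yields weak convergence
(`tendsto_of_tendsto_integral_exp`). -/

namespace DetProc

open scoped CompactlySupported Function

/-! ### Trace norm estimates -/

section TraceNorm

variable {H : Type*} [NormedAddCommGroup H] [InnerProductSpace ℂ H]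

lemma sum_enorm_inner_le_traceNorm {ι : Type*} [Fintype ι] (A : H →L[ℂ] H) {e f : ι → H}
    (he : Orthonormal ℂ e) (hf : Orthonormal ℂ f) :
    ∑ i, ‖⟪f i, A (e i)⟫_ℂ‖ₑ ≤ traceNorm A := by
  let σ := (Fintype.equivFin ι).symm
  rw [← σ.sum_comp]
  exact le_iSup_of_le (Fintype.card ι) <| le_iSup_of_le (e ∘ σ) <| le_iSup_of_le (f ∘ σ) <|
    le_iSup_of_le (he.comp _ σ.injective) <| le_iSup_of_le (hf.comp _ σ.injective) le_rfl

lemma traceNorm_le {A : H →L[ℂ] H} {c : ℝ≥0∞}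
    (h : ∀ (n : ℕ) (e f : Fin n → H), Orthonormal ℂ e → Orthonormal ℂ f →
      ∑ i, ‖⟪f i, A (e i)⟫_ℂ‖ₑ ≤ c) : traceNorm A ≤ c :=
  iSup_le fun n => iSup_le fun e => iSup_le fun f => iSup_le fun he => iSup_le fun hf =>
    h n e f he hf

lemma traceNorm_add_le (A B : H →L[ℂ] H) : traceNorm (A + B) ≤ traceNorm A + traceNorm B := by
  refine traceNorm_le fun n e f he hf => ?_
  calc ∑ i, ‖⟪f i, (A + B) (e i)⟫_ℂ‖ₑ
      ≤ ∑ i, (‖⟪f i, A (e i)⟫_ℂ‖ₑ + ‖⟪f i, B (e i)⟫_ℂ‖ₑ) := by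
        refine Finset.sum_le_sum fun i _ => ?_
        rw [add_apply, inner_add_right]
        exact enorm_add_le _ _
    _ ≤ _ := by
        rw [Finset.sum_add_distrib]
        exact add_le_add (sum_enorm_inner_le_traceNorm A he hf)
          (sum_enorm_inner_le_traceNorm B he hf)

lemma traceNorm_smul_le (c : ℂ) (A : H →L[ℂ] H) : traceNorm (c • A) ≤ ‖c‖ₑ * traceNorm A := by
  refine traceNorm_le fun n e f he hf => ?_
  simp only [smul_apply, inner_smul_right, enorm_mul, ← Finset.mul_sum]
  gcongr
  exact sum_enorm_inner_le_traceNorm A he hf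

lemma traceNorm_neg_le (A : H →L[ℂ] H) : traceNorm (-A) ≤ traceNorm A := by
  simpa using traceNorm_smul_le (-1) A

lemma traceNorm_sub_le (A B : H →L[ℂ] H) : traceNorm (A - B) ≤ traceNorm A + traceNorm B := by
  rw [sub_eq_add_neg]
  exact (traceNorm_add_le _ _).trans (add_le_add le_rfl (traceNorm_neg_le B))

/-- Multiplication from the left by an operator with isometric adjoint does not increase the
trace norm. -/
lemma traceNorm_comp_le_of_isometry (U : H →L[ℂ] H) (W : H →ₗᵢ[ℂ] H)
    (h : ∀ x y, ⟪x, U y⟫_ℂ = ⟪W x, y⟫_ℂ) (A : H →L[ℂ] H) :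
    traceNorm (U ∘L A) ≤ traceNorm A := by
  refine traceNorm_le fun n e f he hf => ?_
  simp only [ContinuousLinearMap.comp_apply, h]
  exact sum_enorm_inner_le_traceNorm A he (hf.comp_linearIsometry W)

/-- Cauchy–Schwarz over the index, then Bessel's inequality for each of the two orthonormal systems.
-/
lemma traceNorm_rankOne_le (u w : H) :
    traceNorm (InnerProductSpace.rankOne ℂ u w) ≤ ENNReal.ofReal (‖u‖ * ‖w‖) := by
  refine traceNorm_le fun n e f he hf => ?_
  have h : ∀ i, ‖⟪f i, InnerProductSpace.rankOne ℂ u w (e i)⟫_ℂ‖ₑ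
      = ENNReal.ofReal (‖⟪f i, u⟫_ℂ‖ * ‖⟪e i, w⟫_ℂ‖) := fun i => by
    rw [InnerProductSpace.rankOne_apply, inner_smul_right, ← ofReal_norm, norm_mul,
      norm_inner_symm w, mul_comm]
  simp only [h]
  rw [← ENNReal.ofReal_sum_of_nonneg fun i _ => by positivity]
  refine ENNReal.ofReal_le_ofReal ?_
  refine (Real.sum_mul_le_sqrt_mul_sqrt _ _ _).trans ?_
  gcongr
  · exact Real.sqrt_le_iff.2 ⟨norm_nonneg _, hf.sum_inner_products_le u⟩
  · exact Real.sqrt_le_iff.2 ⟨norm_nonneg _, he.sum_inner_products_le w⟩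

lemma traceNorm_comp_rankOne_comp_le [CompleteSpace H] (A B : H →L[ℂ] H) (u w : H) :
    traceNorm (A ∘L InnerProductSpace.rankOne ℂ u w ∘L B)
      ≤ ENNReal.ofReal (‖A‖ * ‖u‖ * (‖B‖ * ‖w‖)) := by
  have h : A ∘L InnerProductSpace.rankOne ℂ u w ∘L B
      = InnerProductSpace.rankOne ℂ (A u) (ContinuousLinearMap.adjoint B w) := by
    ext x
    simp [ContinuousLinearMap.adjoint_inner_left]
  rw [h]
  refine (traceNorm_rankOne_le _ _).trans (ENNReal.ofReal_le_ofReal ?_)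
  gcongr
  · exact A.le_opNorm u
  · exact ((ContinuousLinearMap.adjoint B).le_opNorm w).trans_eq (by simp)

end TraceNorm

/-! ### Projection onto a subspace enlarged by one vector -/

section Projections

variable {H : Type*} [NormedAddCommGroup H] [InnerProductSpace ℂ H]

/-- The residual `w = v - P v` spans the orthogonal complement of `K` in `M`. No condition `v ∉ K`
is needed: if `w = 0` the correction vanishes. This matters for the approximating subspaces, where
linear independence is not assumed. -/
lemma starProjection_sup_span_singleton (K M : Submodule ℂ H) [K.HasOrthogonalProjection]
    [M.HasOrthogonalProjection] (v : H) (hM : M = K ⊔ Submodule.span ℂ {v}) :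
    M.starProjection = K.starProjection +
      InnerProductSpace.rankOne ℂ ((‖v - K.starProjection v‖ ^ 2 : ℂ)⁻¹ • (v - K.starProjection v))
        (v - K.starProjection v) := by
  set w := v - K.starProjection v with hw
  have hwK : w ∈ Kᗮ := Submodule.sub_starProjection_mem_orthogonal v
  have hwM : w ∈ M := by
    rw [hM]
    exact sub_mem (Submodule.mem_sup_right (Submodule.mem_span_singleton_self v))
      (Submodule.mem_sup_left (Submodule.starProjection_apply_mem _ _))
  have hKM : K ≤ M := hM ▸ le_sup_left
  ext x
  refine Submodule.eq_starProjection_of_mem_orthogonal ?_ ?_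
  · simp only [add_apply, InnerProductSpace.rankOne_apply]
    exact add_mem (hKM (Submodule.starProjection_apply_mem _ _))
      (M.smul_mem _ (M.smul_mem _ hwM))
  · have key : ∀ y ∈ Kᗮ, ⟪w, y⟫_ℂ = 0 → y ∈ Mᗮ := by
      intro y hy hwy
      rw [hM, ← Submodule.inf_orthogonal]
      refine ⟨hy, Submodule.mem_orthogonal_singleton_iff_inner_right.2 ?_⟩
      have : v = w + K.starProjection v := by simp [hw]
      rw [this, inner_add_left, hwy, zero_add]
      exact hy _ (Submodule.starProjection_apply_mem _ _)
    have hsub : x - K.starProjection x ∈ Kᗮ := Submodule.sub_starProjection_mem_orthogonal x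
    simp only [add_apply, InnerProductSpace.rankOne_apply, ← sub_sub]
    refine key _ (sub_mem hsub (Kᗮ.smul_mem _ (Kᗮ.smul_mem _ hwK))) ?_
    have hKw : ⟪w, K.starProjection x⟫_ℂ = 0 :=
      Submodule.inner_left_of_mem_orthogonal (Submodule.starProjection_apply_mem _ _) hwK
    rw [inner_sub_right, inner_sub_right, hKw, inner_smul_right, inner_smul_right,
      inner_self_eq_norm_sq_to_K]
    by_cases h0 : w = 0
    · simp [h0]
    · have : (‖w‖ : ℂ) ≠ 0 := by simpa using h0
      simp only [Complex.coe_algebraMap]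
      field_simp
      simp

end Projections

/-! ### Convergence of the rank-one correction -/

section OneVector

variable {H : Type*} [NormedAddCommGroup H] [InnerProductSpace ℂ H]

lemma tendsto_sub_starProjection {K' : ℕ → Submodule ℂ H} {K : Submodule ℂ H}
    [∀ n, (K' n).HasOrthogonalProjection] [K.HasOrthogonalProjection]
    (hK : ∀ f, Tendsto (fun n => (K' n).starProjection f) atTop (𝓝 (K.starProjection f)))
    {v' : ℕ → H} {v : H} (hv : Tendsto v' atTop (𝓝 v)) :
    Tendsto (fun n => v' n - (K' n).starProjection (v' n)) atTop
      (𝓝 (v - K.starProjection v)) := by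
  refine hv.sub ?_
  -- Projections are contractions, so strong convergence may be tested on moving vectors.
  have h1 : Tendsto (fun n => (K' n).starProjection (v' n - v)) atTop (𝓝 0) := by
    refine squeeze_zero_norm (fun n => (K' n).norm_starProjection_apply_le _) ?_
    simpa using (hv.sub_const v).norm
  simpa [map_sub] using h1.add (hK v)

lemma tendsto_inv_norm_sq_smul {w' : ℕ → H} {w : H} (hw : Tendsto w' atTop (𝓝 w)) (h0 : w ≠ 0) :
    Tendsto (fun n => (‖w' n‖ ^ 2 : ℂ)⁻¹ • w' n) atTop (𝓝 ((‖w‖ ^ 2 : ℂ)⁻¹ • w)) := by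
  refine Tendsto.smul (Tendsto.inv₀ ?_ (by simpa using h0)) hw
  exact ((Complex.continuous_ofReal.tendsto _).comp hw.norm).pow 2

lemma tendsto_traceNorm_comp_rankOne_sub [CompleteSpace H] (A B : H →L[ℂ] H) {u' w' : ℕ → H}
    {u w : H} (hu : Tendsto u' atTop (𝓝 u)) (hw : Tendsto w' atTop (𝓝 w)) :
    Tendsto (fun n => traceNorm (A ∘L (InnerProductSpace.rankOne ℂ (u' n) (w' n) -
      InnerProductSpace.rankOne ℂ u w) ∘L B)) atTop (𝓝 0) := by
  have hlim : Tendsto (fun n => ENNReal.ofReal (‖A‖ * ‖u' n - u‖ * (‖B‖ * ‖w' n‖)) +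
      ENNReal.ofReal (‖A‖ * ‖u‖ * (‖B‖ * ‖w' n - w‖))) atTop (𝓝 0) := by
    have h1 : Tendsto (fun n => ‖A‖ * ‖u' n - u‖ * (‖B‖ * ‖w' n‖)) atTop (𝓝 0) := by
      simpa using ((hu.sub_const u).norm.const_mul ‖A‖).mul (hw.norm.const_mul ‖B‖)
    have h2 : Tendsto (fun n => ‖A‖ * ‖u‖ * (‖B‖ * ‖w' n - w‖)) atTop (𝓝 0) := by
      simpa using ((hw.sub_const w).norm.const_mul ‖B‖).const_mul (‖A‖ * ‖u‖)
    simpa using (ENNReal.tendsto_ofReal h1).add (ENNReal.tendsto_ofReal h2)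
  refine tendsto_of_tendsto_of_tendsto_of_le_of_le tendsto_const_nhds hlim
    (fun n => zero_le) fun n => ?_
  -- Change one factor of the rank-one operator at a time.
  have : A ∘L (InnerProductSpace.rankOne ℂ (u' n) (w' n) - InnerProductSpace.rankOne ℂ u w) ∘L B
      = A ∘L InnerProductSpace.rankOne ℂ (u' n - u) (w' n) ∘L B
        + A ∘L InnerProductSpace.rankOne ℂ u (w' n - w) ∘L B := by
    ext x
    simp only [ContinuousLinearMap.comp_apply, sub_apply, add_apply, map_sub,
      InnerProductSpace.rankOne_apply]
    simp
  rw [this]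
  exact (traceNorm_add_le _ _).trans (add_le_add (traceNorm_comp_rankOne_comp_le _ _ _ _)
    (traceNorm_comp_rankOne_comp_le _ _ _ _))

end OneVector

/-! ### Adjoining finitely many vectors -/

section Extension

variable {H : Type*} [NormedAddCommGroup H] [InnerProductSpace ℂ H]

lemma tendsto_starProjection_sup_span_singleton {K' M' : ℕ → Submodule ℂ H} {K M : Submodule ℂ H}
    [∀ n, (K' n).HasOrthogonalProjection] [K.HasOrthogonalProjection]
    [∀ n, (M' n).HasOrthogonalProjection] [M.HasOrthogonalProjection]
    {v' : ℕ → H} {v : H} (hM' : ∀ n, M' n = K' n ⊔ Submodule.span ℂ {v' n})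
    (hM : M = K ⊔ Submodule.span ℂ {v})
    (hK : ∀ f, Tendsto (fun n => (K' n).starProjection f) atTop (𝓝 (K.starProjection f)))
    (hv : Tendsto v' atTop (𝓝 v)) (hvK : v ∉ K) (f : H) :
    Tendsto (fun n => (M' n).starProjection f) atTop (𝓝 (M.starProjection f)) := by
  have hw := tendsto_sub_starProjection hK hv
  have h0 : v - K.starProjection v ≠ 0 := fun h =>
    hvK (Submodule.starProjection_eq_self_iff.1 (sub_eq_zero.1 h).symm)
  simp only [fun n => starProjection_sup_span_singleton _ _ _ (hM' n),
    starProjection_sup_span_singleton _ _ _ hM, add_apply, InnerProductSpace.rankOne_apply]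
  exact (hK f).add ((hw.inner tendsto_const_nhds).smul (tendsto_inv_norm_sq_smul hw h0))

lemma isTraceClass_comp_starProjection_sup_span_singleton [CompleteSpace H] {K M : Submodule ℂ H}
    [K.HasOrthogonalProjection] [M.HasOrthogonalProjection] {v : H}
    (hM : M = K ⊔ Submodule.span ℂ {v}) {A B : H →L[ℂ] H}
    (h : IsTraceClass (A ∘L K.starProjection ∘L B)) :
    IsTraceClass (A ∘L M.starProjection ∘L B) := by
  rw [IsTraceClass, starProjection_sup_span_singleton _ _ _ hM, ContinuousLinearMap.add_comp,
    ContinuousLinearMap.comp_add]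
  exact (traceNorm_add_le _ _).trans_lt (ENNReal.add_lt_top.2 ⟨h,
    (traceNorm_comp_rankOne_comp_le _ _ _ _).trans_lt ENNReal.ofReal_lt_top⟩)

lemma tendsto_traceNorm_comp_starProjection_sup_span_singleton [CompleteSpace H]
    {K' M' : ℕ → Submodule ℂ H} {K M : Submodule ℂ H}
    [∀ n, (K' n).HasOrthogonalProjection] [K.HasOrthogonalProjection]
    [∀ n, (M' n).HasOrthogonalProjection] [M.HasOrthogonalProjection]
    {v' : ℕ → H} {v : H} (hM' : ∀ n, M' n = K' n ⊔ Submodule.span ℂ {v' n})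
    (hM : M = K ⊔ Submodule.span ℂ {v})
    (hK : ∀ f, Tendsto (fun n => (K' n).starProjection f) atTop (𝓝 (K.starProjection f)))
    (hv : Tendsto v' atTop (𝓝 v)) (hvK : v ∉ K) {A B : H →L[ℂ] H}
    (h : Tendsto (fun n => traceNorm (A ∘L ((K' n).starProjection - K.starProjection) ∘L B))
      atTop (𝓝 0)) :
    Tendsto (fun n => traceNorm (A ∘L ((M' n).starProjection - M.starProjection) ∘L B))
      atTop (𝓝 0) := by
  have hw := tendsto_sub_starProjection hK hv
  have h0 : v - K.starProjection v ≠ 0 := fun h =>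
    hvK (Submodule.starProjection_eq_self_iff.1 (sub_eq_zero.1 h).symm)
  have hR := tendsto_traceNorm_comp_rankOne_sub A B (tendsto_inv_norm_sq_smul hw h0) hw
  have hsum := h.add hR
  rw [add_zero] at hsum
  refine tendsto_of_tendsto_of_tendsto_of_le_of_le tendsto_const_nhds hsum
    (fun n => zero_le) fun n => ?_
  simp only [fun n => starProjection_sup_span_singleton _ _ _ (hM' n),
    starProjection_sup_span_singleton _ _ _ hM]
  rw [add_sub_add_comm, ContinuousLinearMap.add_comp, ContinuousLinearMap.comp_add]
  exact traceNorm_add_le _ _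

lemma TendstoLocTraceClass.sup_span_singleton {E : Type*} [TopologicalSpace E] [MeasurableSpace E]
    {μ : Measure E} {K' M' : ℕ → Submodule ℂ (Lp ℂ 2 μ)} {K M : Submodule ℂ (Lp ℂ 2 μ)}
    [∀ n, (K' n).HasOrthogonalProjection] [K.HasOrthogonalProjection]
    [∀ n, (M' n).HasOrthogonalProjection] [M.HasOrthogonalProjection]
    {v' : ℕ → Lp ℂ 2 μ} {v : Lp ℂ 2 μ} (hM' : ∀ n, M' n = K' n ⊔ Submodule.span ℂ {v' n})
    (hM : M = K ⊔ Submodule.span ℂ {v})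
    (hK : ∀ f, Tendsto (fun n => (K' n).starProjection f) atTop (𝓝 (K.starProjection f)))
    (hv : Tendsto v' atTop (𝓝 v)) (hvK : v ∉ K)
    (h : TendstoLocTraceClass μ (fun n => (K' n).starProjection) K.starProjection) :
    TendstoLocTraceClass μ (fun n => (M' n).starProjection) M.starProjection :=
  ⟨fun n B hB => isTraceClass_comp_starProjection_sup_span_singleton (H := Lp ℂ 2 μ) (hM' n)
      (h.1 n B hB),
    fun B hB => isTraceClass_comp_starProjection_sup_span_singleton (H := Lp ℂ 2 μ) hM
      (h.2.1 B hB),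
    fun B hB => tendsto_traceNorm_comp_starProjection_sup_span_singleton (H := Lp ℂ 2 μ)
      hM' hM hK hv hvK (h.2.2 B hB)⟩

lemma extend_succ [CompleteSpace H] (L : ClosedSubmodule ℂ H) {m : ℕ} (v : Fin (m + 1) → H) :
    (extend L v).toSubmodule = (extend L (v ∘ Fin.castSucc)).toSubmodule ⊔
      Submodule.span ℂ {v (Fin.last m)} := by
  have : range v = range (v ∘ Fin.castSucc) ∪ {v (Fin.last m)} := by
    ext x
    simp [Fin.exists_fin_succ', eq_comm, or_comm]
  simp only [extend, this, Submodule.span_union, sup_assoc]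

lemma extend_zero [CompleteSpace H] (L : ClosedSubmodule ℂ H) (v : Fin 0 → H) :
    extend L v = L := by
  apply ClosedSubmodule.toSubmodule_injective
  simp [extend, range_eq_empty]

/-- Induction on `m`, splitting off the last vector. Both convergences are carried together because
the trace-class step needs strong convergence at the previous stage. -/
theorem tendsto_extend {E : Type*} [TopologicalSpace E] [MeasurableSpace E] {μ : Measure E}
    {L' : ℕ → ClosedSubmodule ℂ (Lp ℂ 2 μ)} {L : ClosedSubmodule ℂ (Lp ℂ 2 μ)}
    (hL : ∀ f : Lp ℂ 2 μ, Tendsto (fun n => (L' n).toSubmodule.starProjection f) atTop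
      (𝓝 (L.toSubmodule.starProjection f))) :
    ∀ {m : ℕ} {v' : ℕ → Fin m → Lp ℂ 2 μ} {v : Fin m → Lp ℂ 2 μ},
    (∀ i, Tendsto (fun n => v' n i) atTop (𝓝 (v i))) →
    (∀ k, v k ∉ L.toSubmodule ⊔ Submodule.span ℂ (v '' Set.Iio k)) →
    (∀ f : Lp ℂ 2 μ,
      Tendsto (fun n => (extend (L' n) (v' n)).toSubmodule.starProjection f) atTop
        (𝓝 ((extend L v).toSubmodule.starProjection f))) ∧
    (TendstoLocTraceClass μ (fun n => (L' n).toSubmodule.starProjection)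
        L.toSubmodule.starProjection →
      TendstoLocTraceClass μ (fun n => (extend (L' n) (v' n)).toSubmodule.starProjection)
        (extend L v).toSubmodule.starProjection) := by
  intro m
  induction m with
  | zero =>
    intro v' v _ _
    simp only [extend_zero]
    exact ⟨hL, id⟩
  | succ m ih =>
    intro v' v hv hind
    obtain ⟨ih1, ih2⟩ := ih (v' := fun n => v' n ∘ Fin.castSucc) (v := v ∘ Fin.castSucc)
      (fun i => hv _) (fun k => by
        change v k.castSucc ∉ _
        convert hind k.castSucc using 4
        ext x
        constructor
        · rintro ⟨i, hi, rfl⟩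
          exact ⟨i.castSucc, by simpa using hi, rfl⟩
        · rintro ⟨i, hi, rfl⟩
          have hne : i ≠ Fin.last m := (lt_of_lt_of_le hi (Fin.le_last _)).ne
          exact ⟨i.castPred hne, by simpa [Fin.castPred_lt_iff] using hi, by simp⟩)
    have hlast : v (Fin.last m) ∉ (extend L (v ∘ Fin.castSucc)).toSubmodule := by
      convert hind (Fin.last m) using 2
      simp only [extend]
      congr 2
      ext x
      constructor
      · rintro ⟨i, rfl⟩
        exact ⟨i.castSucc, by simp [Fin.castSucc_lt_last], rfl⟩
      · rintro ⟨i, hi, rfl⟩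
        exact ⟨i.castPred (ne_of_lt hi), by simp⟩
    exact ⟨tendsto_starProjection_sup_span_singleton (fun n => extend_succ (L' n) (v' n))
      (extend_succ L v) ih1 (hv _) hlast,
      fun h => (ih2 h).sup_span_singleton (fun n => extend_succ (L' n) (v' n))
        (extend_succ L v) ih1 (hv _) hlast⟩

end Extension

/-! ### Continuity of Fredholm determinants -/

section FredholmDeterminant

/-- Hadamard's inequality for the determinant with respect to an orthonormal basis. -/
lemma norm_det_orthonormalBasis_le {n : ℕ} {V : Type*} [NormedAddCommGroup V]
    [InnerProductSpace ℂ V] (e : OrthonormalBasis (Fin n) ℂ V) (v : Fin n → V) :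
    ‖e.toBasis.det v‖ ≤ ∏ i, ‖v i‖ := by
  have : FiniteDimensional ℂ V := e.toBasis.finiteDimensional_of_finite
  have hdim : Module.finrank ℂ V = Fintype.card (Fin n) :=
    Module.finrank_eq_card_basis e.toBasis
  set g := InnerProductSpace.gramSchmidtOrthonormalBasis hdim v with hg
  -- In the Gram–Schmidt basis `g` the matrix of `v` is triangular with diagonal `⟪g i, v i⟫`;
  -- passing between orthonormal bases costs a factor of modulus one.
  have h1 : e.toBasis.det v = e.toBasis.det g * g.toBasis.det v := by
    rw [e.toBasis.det.eq_smul_basis_det g.toBasis]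
    simp [g.toBasis.det_self, ← OrthonormalBasis.coe_toBasis g, -OrthonormalBasis.coe_toBasis]
  rw [h1, norm_mul, OrthonormalBasis.det_to_matrix_orthonormalBasis, one_mul, hg,
    InnerProductSpace.gramSchmidtOrthonormalBasis_det, norm_prod]
  refine Finset.prod_le_prod (fun _ _ => norm_nonneg _) fun i _ => ?_
  exact (norm_inner_le_norm _ _).trans_eq (by simp)

lemma norm_det_one_add_le_exp_sum {n : ℕ} {V : Type*} [NormedAddCommGroup V]
    [InnerProductSpace ℂ V] (e : OrthonormalBasis (Fin n) ℂ V) (M : V →ₗ[ℂ] V) :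
    ‖LinearMap.det (1 + M)‖ ≤ Real.exp (∑ i, ‖M (e i)‖) := by
  have h1 : LinearMap.det (1 + M) = e.toBasis.det (fun i => (1 + M) (e i)) := by
    have := e.toBasis.det_comp (1 + M) e.toBasis
    rw [e.toBasis.det_self, mul_one] at this
    rw [← this]
    congr 1
  rw [h1, Real.exp_sum]
  refine (norm_det_orthonormalBasis_le e _).trans ?_
  refine Finset.prod_le_prod (fun _ _ => norm_nonneg _) fun i _ => ?_
  calc ‖(1 + M) (e i)‖ ≤ ‖e i‖ + ‖M (e i)‖ := by simpa using norm_add_le (e i) (M (e i))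
    _ = ‖M (e i)‖ + 1 := by simp [add_comm]
    _ ≤ _ := Real.add_one_le_exp _

/-- In a finite dimensional space there is an orthonormal basis which a given operator maps to an
orthogonal system. -/
lemma exists_orthonormalBasis_orthogonal_image {V : Type*} [NormedAddCommGroup V]
    [InnerProductSpace ℂ V] [FiniteDimensional ℂ V] (M : V →ₗ[ℂ] V) :
    ∃ e : OrthonormalBasis (Fin (Module.finrank ℂ V)) ℂ V,
      ∀ i j, i ≠ j → ⟪M (e i), M (e j)⟫_ℂ = 0 := by
  -- Eigenvectors of `M* M` work, as `⟪M eᵢ, M eⱼ⟫ = ⟪eᵢ, M* M eⱼ⟫`.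
  have hS : (LinearMap.adjoint M ∘ₗ M).IsSymmetric := M.isSymmetric_adjoint_mul_self
  refine ⟨hS.eigenvectorBasis rfl, fun i j hij => ?_⟩
  rw [← LinearMap.adjoint_inner_right, ← LinearMap.comp_apply, hS.apply_eigenvectorBasis,
    inner_smul_right, (hS.eigenvectorBasis rfl).orthonormal.2 hij, mul_zero]

variable {H : Type*} [NormedAddCommGroup H] [InnerProductSpace ℂ H]

/-- The determinant of a compression of `1 + T` to a finite dimensional subspace is bounded in
terms of the trace norm of `T`. -/
lemma norm_det_one_add_le_exp_traceNorm {V : Type*} [NormedAddCommGroup V]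
    [InnerProductSpace ℂ V] [FiniteDimensional ℂ V] (J : V →ₗᵢ[ℂ] H) (M : V →ₗ[ℂ] V)
    (T : H →L[ℂ] H) (hT : traceNorm T ≠ ∞) (hM : ∀ x y, ⟪x, M y⟫_ℂ = ⟪J x, T (J y)⟫_ℂ) :
    ‖LinearMap.det (1 + M)‖ ≤ Real.exp (traceNorm T).toReal := by
  obtain ⟨e, he⟩ := exists_orthonormalBasis_orthogonal_image M
  refine (norm_det_one_add_le_exp_sum e M).trans (Real.exp_le_exp.2 ?_)
  classical
  -- The `‖M eᵢ‖` are the singular values of `M`. Discarding the zero ones lets the images be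
  -- normalised; the resulting pair of systems, moved to `H` by `J`, competes in the supremum
  -- defining `traceNorm T`.
  let S := {i // M (e i) ≠ 0}
  let a : S → V := fun i => e i
  let f : S → V := fun i => ((‖M (e i)‖ : ℂ)⁻¹) • M (e i)
  have ha : Orthonormal ℂ a := e.orthonormal.comp _ Subtype.val_injective
  have hf : Orthonormal ℂ f := by
    refine ⟨fun i => norm_smul_inv_norm i.2, fun i j hij => ?_⟩
    simp [f, inner_smul_left, inner_smul_right, he i j (fun h => hij (Subtype.ext h))]
  have hsum := sum_enorm_inner_le_traceNorm T (ha.comp_linearIsometry J)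
    (hf.comp_linearIsometry J)
  have hterm : ∀ i : S, ‖⟪(J ∘ f) i, T ((J ∘ a) i)⟫_ℂ‖ₑ = ENNReal.ofReal ‖M (e i)‖ := by
    intro i
    have hn : ‖M (e i)‖ ≠ 0 := norm_ne_zero_iff.2 i.2
    rw [Function.comp, Function.comp, ← hM, ← ofReal_norm]
    simp only [f, a, inner_smul_left, inner_self_eq_norm_sq_to_K, norm_mul]
    congr 1
    simp
    field_simp
  simp only [hterm] at hsum
  rw [← ENNReal.ofReal_sum_of_nonneg fun _ _ => norm_nonneg _,
    ENNReal.ofReal_le_iff_le_toReal hT] at hsum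
  refine le_trans (le_of_eq ?_) hsum
  rw [← Finset.sum_subtype (Finset.univ.filter fun i => M (e i) ≠ 0) (by simp)
    (fun i => ‖M (e i)‖), Finset.sum_filter_of_ne fun i _ hi => norm_ne_zero_iff.1 hi]

/-- The finite section `(⟨b i, T (b j)⟩)_{i, j ∈ F}` of an operator in an orthonormal system. -/
noncomputable def finiteSection {ι : Type*} (b : ι → H) (F : Finset ι) (T : H →L[ℂ] H) :
    Matrix F F ℂ :=
  Matrix.of fun i j : F => ⟪b i, T (b j)⟫_ℂ

lemma norm_det_one_add_finiteSection_le {ι : Type*} [DecidableEq ι] {b : ι → H} (hb : Orthonormal ℂ b)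
    (F : Finset ι) {T : H →L[ℂ] H} (hT : traceNorm T ≠ ∞) :
    ‖(1 + finiteSection b F T).det‖ ≤ Real.exp (traceNorm T).toReal := by
  let bF : F → H := fun i => b i
  have hbF : Orthonormal ℂ bF := hb.comp _ Subtype.val_injective
  let J₀ : EuclideanSpace ℂ F →ₗ[ℂ] H :=
    { toFun := fun x => ∑ i, x i • bF i
      map_add' := fun x y => by simp [add_smul, Finset.sum_add_distrib]
      map_smul' := fun c x => by simp [mul_smul, Finset.smul_sum] }
  -- The finite section is the compression of `T` along this isometry onto the span of the `b i`, `i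
  -- ∈ F`.
  let J : EuclideanSpace ℂ F →ₗᵢ[ℂ] H := J₀.isometryOfInner fun x y => by
    simp only [J₀, LinearMap.coe_mk, AddHom.coe_mk, hbF.inner_sum, PiLp.inner_apply]
    simp [mul_comm]
  have h := norm_det_one_add_le_exp_traceNorm J (finiteSection b F T).toEuclideanLin T hT
    fun x y => by
      change _ = ⟪∑ i, x i • bF i, T (∑ i, y i • bF i)⟫_ℂ
      simp only [PiLp.inner_apply, map_sum, map_smul, sum_inner, inner_sum, inner_smul_left,
        inner_smul_right]
      simp [Matrix.toLpLin_apply, Matrix.mulVec, dotProduct, finiteSection, bF, Finset.mul_sum,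
        Finset.sum_mul]
      rw [Finset.sum_comm]
      exact Finset.sum_congr rfl fun i _ => Finset.sum_congr rfl fun j _ => by ring
  have hdet : LinearMap.det (1 + (finiteSection b F T).toEuclideanLin)
      = (1 + finiteSection b F T).det := by
    have : (1 : EuclideanSpace ℂ F →ₗ[ℂ] EuclideanSpace ℂ F) = (1 : Matrix F F ℂ).toEuclideanLin := by
      ext
      simp
    rw [this, ← map_add]
    exact (congrArg LinearMap.det (DFunLike.congr_fun (Matrix.toLpLin_eq_toLin 2 2) _)).trans
      (LinearMap.det_toLin _ _)
  rwa [hdet] at h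

/-- The Schwarz lemma for the polynomial `z ↦ det (1 + A_F + z D_F)`: on `|z| < R` the perturbation
`z D` has trace norm at most one, which bounds the polynomial there, and the points `0` and `1` are
compared. The estimate does not involve `F`. -/
lemma norm_det_one_add_finiteSection_sub_le {ι : Type*} [DecidableEq ι] {b : ι → H} (hb : Orthonormal ℂ b)
    (F : Finset ι) {A D : H →L[ℂ] H} (hA : traceNorm A ≠ ∞) {R : ℝ} (hR : 1 < R)
    (hD : traceNorm D ≤ ENNReal.ofReal R⁻¹) :
    ‖(1 + finiteSection b F (A + D)).det - (1 + finiteSection b F A).det‖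
      ≤ 2 * Real.exp ((traceNorm A).toReal + 1) / R := by
  have hR0 : 0 < R := by linarith
  let f : ℂ → ℂ := fun z => (1 + finiteSection b F (A + z • D)).det
  have hf : Differentiable ℂ f := by
    have : f = fun z => (1 + finiteSection b F A + z • finiteSection b F D).det := by
      ext z
      simp only [f]
      congr 1
      ext i j
      simp [finiteSection, add_assoc]
    rw [this]
    simp only [Matrix.det_apply]
    simp only [Matrix.add_apply, Matrix.smul_apply]
    fun_prop
  have hbd : ∀ z ∈ Metric.ball (0 : ℂ) R, ‖f z‖ ≤ Real.exp ((traceNorm A).toReal + 1) := by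
    intro z hz
    have hz' : ‖z‖ ≤ R := by simpa using (mem_ball_zero_iff.1 hz).le
    have hle : traceNorm (A + z • D) ≤ traceNorm A + 1 := by
      refine (traceNorm_add_le _ _).trans (add_le_add le_rfl ((traceNorm_smul_le _ _).trans ?_))
      calc ‖z‖ₑ * traceNorm D ≤ ENNReal.ofReal R * ENNReal.ofReal R⁻¹ := by
            rw [← ofReal_norm]
            gcongr
        _ = 1 := by
            rw [← ENNReal.ofReal_mul hR0.le, mul_inv_cancel₀ hR0.ne', ENNReal.ofReal_one]
    have hfin : traceNorm A + 1 ≠ ∞ := by simp [hA]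
    refine (norm_det_one_add_finiteSection_le hb F (ne_top_of_le_ne_top hfin hle)).trans ?_
    rw [Real.exp_le_exp]
    refine (ENNReal.toReal_mono hfin hle).trans_eq ?_
    rw [ENNReal.toReal_add hA ENNReal.one_ne_top, ENNReal.toReal_one]
  -- The target ball is centred at `f 0`, whence the factor 2 in its radius.
  have h := Complex.dist_le_div_mul_dist_of_mapsTo_ball (f := f) (c := 0) (z := 1) (R₁ := R)
    (R₂ := 2 * Real.exp ((traceNorm A).toReal + 1)) hf.differentiableOn (fun z hz => by
      rw [Metric.mem_closedBall, dist_eq_norm, two_mul]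
      exact (norm_sub_le _ _).trans (add_le_add (hbd z hz) (hbd 0 (by simpa using hR0))))
    (by simpa using hR)
  simpa [f, dist_eq_norm] using h

open scoped Classical in
/-- The Fredholm determinant is continuous in trace norm. -/
theorem HasFredholmDet.tendsto [CompleteSpace H] {A' : ℕ → H →L[ℂ] H} {A : H →L[ℂ] H}
    {d' : ℕ → ℂ} {d : ℂ} (h' : ∀ n, HasFredholmDet (A' n) (d' n)) (h : HasFredholmDet A d)
    (hA : traceNorm A ≠ ∞) (hlim : Tendsto (fun n => traceNorm (A' n - A)) atTop (𝓝 0)) :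
    Tendsto d' atTop (𝓝 d) := by
  obtain ⟨w, b, -⟩ := exists_hilbertBasis ℂ H
  have key : ∀ R : ℝ, 1 < R → ∀ᶠ n in atTop,
      ‖d' n - d‖ ≤ 2 * Real.exp ((traceNorm A).toReal + 1) / R := by
    intro R hR
    have hpos : 0 < ENNReal.ofReal R⁻¹ := by
      rw [ENNReal.ofReal_pos]
      positivity
    filter_upwards [hlim.eventually (ge_mem_nhds hpos)] with n hn
    -- Uniformity in `F` lets the bound pass to the limit over finite sections of a single basis.
    refine le_of_tendsto ((h' n w b).sub (h w b)).norm (Eventually.of_forall fun F => ?_)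
    have hle := norm_det_one_add_finiteSection_sub_le b.orthonormal F hA hR hn
    rw [add_sub_cancel] at hle
    exact hle
  have hR : Tendsto (fun R : ℝ => 2 * Real.exp ((traceNorm A).toReal + 1) / R) atTop (𝓝 0) :=
    tendsto_const_nhds.div_atTop tendsto_id
  rw [Metric.tendsto_nhds]
  intro ε hε
  obtain ⟨R, hR1, hRε⟩ := ((eventually_gt_atTop 1).and (hR.eventually (gt_mem_nhds hε))).exists
  filter_upwards [key R hR1] with n hn
  exact (dist_eq_norm (d' n) d).trans_lt (hn.trans_lt hRε)

end FredholmDeterminant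

/-! ### Multiplication operators and local trace norms -/

section Multiplication

variable {E : Type*} [MeasurableSpace E] {μ : Measure E}

lemma coeFn_mulOp {f : E → ℂ} (hf : MemLp f ∞ μ) (u : Lp ℂ 2 μ) :
    mulOp μ f u =ᵐ[μ] fun x => f x * u x := by
  rw [mulOp, dif_pos hf]
  refine ((ContinuousLinearMap.mul ℂ ℂ).coeFn_holder (hf.toLp f) u).trans ?_
  filter_upwards [hf.coeFn_toLp] with x hx
  simp [hx]

lemma memLp_top_of_norm_eq_one {g : E → ℂ} (hg : Measurable g) (h1 : ∀ x, ‖g x‖ = 1) :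
    MemLp g ∞ μ :=
  memLp_top_of_bound hg.aestronglyMeasurable 1 (Eventually.of_forall fun x => (h1 x).le)

/-- Multiplication by a unimodular function as an isometry. -/
noncomputable def mulIsometry (μ : Measure E) {g : E → ℂ} (hg : Measurable g)
    (h1 : ∀ x, ‖g x‖ = 1) : Lp ℂ 2 μ →ₗᵢ[ℂ] Lp ℂ 2 μ where
  toLinearMap := (mulOp μ g).toLinearMap
  norm_map' u := by
    change ‖mulOp μ g u‖ = ‖u‖
    rw [Lp.norm_def, Lp.norm_def]
    congr 1
    refine eLpNorm_congr_norm_ae ?_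
    filter_upwards [coeFn_mulOp (memLp_top_of_norm_eq_one hg h1) u] with x hx
    rw [hx, norm_mul, h1, one_mul]

lemma inner_mulOp {g : E → ℂ} (hg : MemLp g ∞ μ) (hg' : MemLp (fun x => starRingEnd ℂ (g x)) ∞ μ)
    (u w : Lp ℂ 2 μ) :
    ⟪u, mulOp μ g w⟫_ℂ = ⟪mulOp μ (fun x => starRingEnd ℂ (g x)) u, w⟫_ℂ := by
  rw [L2.inner_def, L2.inner_def]
  refine integral_congr_ae ?_
  filter_upwards [coeFn_mulOp hg w, coeFn_mulOp hg' u] with x hx hx'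
  rw [hx, hx']
  simp only [RCLike.inner_apply, map_mul, Complex.conj_conj]
  ring

lemma traceNorm_mulOp_comp_le {g : E → ℂ} (hg : Measurable g) (h1 : ∀ x, ‖g x‖ = 1)
    (A : Lp ℂ 2 μ →L[ℂ] Lp ℂ 2 μ) : traceNorm (mulOp μ g ∘L A) ≤ traceNorm A := by
  have hg' : Measurable fun x => starRingEnd ℂ (g x) := Complex.continuous_conj.measurable.comp hg
  have h1' : ∀ x, ‖starRingEnd ℂ (g x)‖ = 1 := fun x => by simp [h1]
  exact traceNorm_comp_le_of_isometry (mulOp μ g) (mulIsometry μ hg' h1')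
    (inner_mulOp (memLp_top_of_norm_eq_one hg h1) (memLp_top_of_norm_eq_one hg' h1')) A

/-- Since `g - 1 = (g - 1) χ_B`, a cutoff can be extracted on the left, which brings the
determinant's operator into the form `χ_B K χ_B` seen by the local seminorms. -/
lemma mulOp_sub_one {g : E → ℂ} {B : Set E} (hg : Measurable g) (h1 : ∀ x, ‖g x‖ = 1)
    (hB : MeasurableSet B) (hgB : ∀ x ∉ B, g x = 1) :
    mulOp μ (fun x => g x - 1) =
      (mulOp μ g - ContinuousLinearMap.id ℂ _) ∘L cutoff μ B := by
  have hg1 : MemLp (fun x => g x - 1) ∞ μ :=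
    memLp_top_of_bound (hg.sub_const 1).aestronglyMeasurable 2 (Eventually.of_forall fun x =>
      (norm_sub_le _ _).trans (by rw [h1, norm_one]; norm_num))
  have hχ : MemLp (B.indicator fun _ => (1 : ℂ)) ∞ μ :=
    memLp_top_of_bound (measurable_const.indicator hB).aestronglyMeasurable 1
      (Eventually.of_forall fun x => (norm_indicator_le_norm_self _ _).trans (by simp))
  ext u
  refine (coeFn_mulOp hg1 u).trans ?_
  simp only [ContinuousLinearMap.comp_apply, sub_apply, ContinuousLinearMap.id_apply]
  filter_upwards [coeFn_mulOp hχ u, coeFn_mulOp (memLp_top_of_norm_eq_one hg h1) (cutoff μ B u),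
    Lp.coeFn_sub (mulOp μ g (cutoff μ B u)) (cutoff μ B u)] with x h2 h3 h4
  rw [h4, Pi.sub_apply, h3, cutoff, h2]
  by_cases hx : x ∈ B
  · simp [hx, sub_mul]
  · simp [hx, hgB x hx]

lemma traceNorm_mulOp_sub_one_comp_le {g : E → ℂ} {B : Set E} (hg : Measurable g)
    (h1 : ∀ x, ‖g x‖ = 1) (hB : MeasurableSet B) (hgB : ∀ x ∉ B, g x = 1)
    (K : Lp ℂ 2 μ →L[ℂ] Lp ℂ 2 μ) :
    traceNorm (mulOp μ (fun x => g x - 1) ∘L K) ≤ 2 * traceNorm (cutoff μ B ∘L K) := by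
  rw [mulOp_sub_one hg h1 hB hgB, ContinuousLinearMap.comp_assoc, ContinuousLinearMap.sub_comp,
    ContinuousLinearMap.id_comp, two_mul]
  exact (traceNorm_sub_le _ _).trans (add_le_add (traceNorm_mulOp_comp_le hg h1 _) le_rfl)

variable [TopologicalSpace E]

theorem TendstoLocTraceClass.tendsto_fredholmDet {K' : ℕ → Lp ℂ 2 μ →L[ℂ] Lp ℂ 2 μ}
    {K : Lp ℂ 2 μ →L[ℂ] Lp ℂ 2 μ} (h : TendstoLocTraceClass μ K' K) {g : E → ℂ} {B : Set E}
    (hg : Measurable g) (h1 : ∀ x, ‖g x‖ = 1) (hB : IsBoundedBorel B) (hgB : ∀ x ∉ B, g x = 1)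
    {d' : ℕ → ℂ} {d : ℂ}
    (hd' : ∀ n, HasFredholmDet (mulOp μ (fun x => g x - 1) ∘L K' n ∘L cutoff μ B) (d' n))
    (hd : HasFredholmDet (mulOp μ (fun x => g x - 1) ∘L K ∘L cutoff μ B) d) :
    Tendsto d' atTop (𝓝 d) := by
  refine HasFredholmDet.tendsto hd' hd ?_ ?_
  · exact ((traceNorm_mulOp_sub_one_comp_le hg h1 hB.1 hgB _).trans_lt
      (ENNReal.mul_lt_top (by simp) (h.2.1 B hB))).ne
  · have hlim := ENNReal.Tendsto.const_mul (a := 2) (h.2.2 B hB) (Or.inr (by simp))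
    rw [mul_zero] at hlim
    refine tendsto_of_tendsto_of_tendsto_of_le_of_le tendsto_const_nhds hlim
      (fun n => zero_le) fun n => ?_
    rw [← ContinuousLinearMap.comp_sub, ← ContinuousLinearMap.sub_comp]
    exact traceNorm_mulOp_sub_one_comp_le hg h1 hB.1 hgB _

end Multiplication

/-! ### Linear statistics and their characteristic functions -/

section LinearStatistics

variable {E : Type*} [TopologicalSpace E]

lemma Conf.finite_tsupport_inter (φ : C_c(E, ℝ)) (X : Conf E) :
    (tsupport φ ∩ Function.support X.mult).Finite :=
  X.finite_inter _ (by rw [isClosed_tsupport φ |>.closure_eq]; exact φ.hasCompactSupport)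

lemma Conf.sum_eq_sum (φ : C_c(E, ℝ)) (X : Conf E) {s : Finset E}
    (hs : tsupport φ ∩ Function.support X.mult ⊆ s) :
    X.sum φ = ∑ x ∈ s, (X.mult x : ℝ) * φ x := by
  refine finsum_eq_sum_of_support_subset _ fun x hx => hs ?_
  have hx' : (X.mult x : ℝ) * φ x ≠ 0 := hx
  exact ⟨subset_tsupport _ (right_ne_zero_of_mul hx'),
    Nat.cast_ne_zero.1 (left_ne_zero_of_mul hx')⟩

/-- Reduces joint characteristic functions of several linear statistics to that of a single one. -/
lemma Conf.sum_sum_smul {ι : Type*} (s : Finset ι) (t : ι → ℝ) (φ : ι → C_c(E, ℝ)) (X : Conf E) :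
    X.sum (∑ i ∈ s, t i • φ i : C_c(E, ℝ)) = ∑ i ∈ s, t i * X.sum (φ i) := by
  classical
  let F : Finset E := (X.finite_tsupport_inter (∑ i ∈ s, t i • φ i)).toFinset ∪
    s.biUnion fun i => (X.finite_tsupport_inter (φ i)).toFinset
  have hF : ∀ i ∈ s, X.sum (φ i) = ∑ x ∈ F, (X.mult x : ℝ) * φ i x := fun i hi =>
    X.sum_eq_sum _ fun x hx => by
      simp only [F, Finset.coe_union, Finset.coe_biUnion]
      exact Or.inr (mem_biUnion hi (by simpa using hx))
  rw [X.sum_eq_sum _ (s := F) fun x hx => by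
    simp only [F, Finset.coe_union]
    exact Or.inl (by simpa using hx)]
  rw [Finset.sum_congr rfl fun i hi => congrArg (t i * ·) (hF i hi)]
  simp only [Finset.mul_sum, CompactlySupportedContinuousMap.coe_sum, Finset.sum_apply,
    CompactlySupportedContinuousMap.coe_smul, Pi.smul_apply, smul_eq_mul]
  rw [Finset.sum_comm]
  exact Finset.sum_congr rfl fun x _ => Finset.sum_congr rfl fun i _ => by ring

lemma Conf.abs_sum_sub_sum_le {φ ψ χ : C_c(E, ℝ)} {c : ℝ} (h : ∀ x, |φ x - ψ x| ≤ c * χ x)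
    (X : Conf E) : |X.sum φ - X.sum ψ| ≤ c * X.sum χ := by
  classical
  let F : Finset E := (X.finite_tsupport_inter φ).toFinset ∪ (X.finite_tsupport_inter ψ).toFinset
    ∪ (X.finite_tsupport_inter χ).toFinset
  rw [X.sum_eq_sum φ (s := F) fun x hx => by simp [F] at hx ⊢; tauto,
    X.sum_eq_sum ψ (s := F) fun x hx => by simp [F] at hx ⊢; tauto,
    X.sum_eq_sum χ (s := F) fun x hx => by simp [F] at hx ⊢; tauto,
    ← Finset.sum_sub_distrib, Finset.mul_sum]
  refine (Finset.abs_sum_le_sum_abs _ _).trans (Finset.sum_le_sum fun x _ => ?_)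
  rw [← mul_sub, abs_mul, Nat.abs_cast, mul_left_comm]
  exact mul_le_mul_of_nonneg_left (h x) (Nat.cast_nonneg _)

lemma Conf.prod_exp (φ : C_c(E, ℝ)) (X : Conf E) :
    X.prod (fun x => Complex.exp (φ x * Complex.I)) = Complex.exp (X.sum φ * Complex.I) := by
  have hfin := X.finite_tsupport_inter φ
  rw [X.sum_eq_sum φ (s := hfin.toFinset) (by simp), Conf.prod,
    finprod_eq_prod_of_mulSupport_subset (s := hfin.toFinset)]
  · push_cast
    rw [Finset.sum_mul, Complex.exp_sum]
    exact Finset.prod_congr rfl fun x _ => by rw [← Complex.exp_nat_mul, mul_assoc]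
  · intro x hx
    rw [hfin.coe_toFinset]
    constructor
    · refine subset_tsupport _ fun h0 => hx ?_
      simp [h0]
    · intro h0
      exact hx (by simp [h0])

lemma isBoundedBorel_tsupport [MeasurableSpace E] [BorelSpace E] (φ : C_c(E, ℝ)) :
    IsBoundedBorel (tsupport φ) :=
  ⟨(isClosed_tsupport φ).measurableSet, by
    rw [isClosed_tsupport φ |>.closure_eq]; exact φ.hasCompactSupport⟩

/-- The characteristic functions of linear statistics converge. -/
theorem TendstoLocTraceClass.tendsto_integral_exp [MeasurableSpace E] [BorelSpace E]
    {μ : Measure E} {K' : ℕ → Lp ℂ 2 μ →L[ℂ] Lp ℂ 2 μ} {K : Lp ℂ 2 μ →L[ℂ] Lp ℂ 2 μ}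
    (h : TendstoLocTraceClass μ K' K) {P' : ℕ → ProbabilityMeasure (Conf E)}
    {P : ProbabilityMeasure (Conf E)} (hP' : ∀ n, IsDeterminantal μ (K' n) (P' n))
    (hP : IsDeterminantal μ K P) (φ : C_c(E, ℝ)) :
    Tendsto (fun n => ∫ X, Complex.exp (Conf.sum φ X * Complex.I) ∂(P' n : Measure (Conf E)))
      atTop (𝓝 (∫ X, Complex.exp (Conf.sum φ X * Complex.I) ∂(P : Measure (Conf E)))) := by
  let g : E → ℂ := fun x => Complex.exp (φ x * Complex.I)
  have hg : Measurable g := by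
    have hc : Continuous g := by
      have := φ.continuous
      fun_prop
    exact hc.measurable
  have h1 : ∀ x, ‖g x‖ = 1 := fun x => Complex.norm_exp_ofReal_mul_I _
  have hgB : ∀ x ∉ tsupport φ, g x = 1 := fun x hx => by
    simp [g, image_eq_zero_of_notMem_tsupport hx]
  have hB := isBoundedBorel_tsupport φ
  simp only [← Conf.prod_exp]
  exact h.tendsto_fredholmDet hg h1 hB hgB
    (fun n => ((hP' n).2 g _ hg ⟨1, fun x => (h1 x).le⟩ hB hgB).2)
    (hP.2 g _ hg ⟨1, fun x => (h1 x).le⟩ hB hgB).2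

end LinearStatistics

/-! ### Second countability of the vague topology -/

section SecondCountable

variable {E : Type*} [TopologicalSpace E] [LocallyCompactSpace E] [SecondCountableTopology E]

/-- A countable family of compactly supported functions that is dense, uniformly on a compact
set, among the functions supported there. -/
lemma exists_countable_dense_of_isCompact {K : Set E} (hK : IsCompact K) :
    ∃ D : Set C_c(E, ℝ), D.Countable ∧ (∀ ψ ∈ D, tsupport ψ ⊆ K) ∧
      ∀ φ : C_c(E, ℝ), tsupport φ ⊆ K → ∀ ε > 0, ∃ ψ ∈ D, ∀ x ∈ K, |φ x - ψ x| < ε := by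
  let T := {φ : C_c(E, ℝ) // tsupport φ ⊆ K}
  let j : T → C(E, ℝ) := fun φ => φ.1.toContinuousMap
  -- The compact-open topology of `C(E, ℝ)` is second countable, a property inherited by induced
  -- topologies; a countable dense set can thus be chosen inside `T` itself.
  let _ : TopologicalSpace T := TopologicalSpace.induced j inferInstance
  have : SecondCountableTopology T := TopologicalSpace.secondCountableTopology_induced T C(E, ℝ) j
  obtain ⟨s, hs, hd⟩ := TopologicalSpace.exists_countable_dense T
  refine ⟨Subtype.val '' s, hs.image _, ?_, fun φ hφ ε hε => ?_⟩
  · rintro _ ⟨ψ, -, rfl⟩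
    exact ψ.2
  · have hj : Continuous j := continuous_induced_dom
    have hunif := (ContinuousMap.tendsto_iff_forall_isCompact_tendstoUniformlyOn.1
      (hj.tendsto ⟨φ, hφ⟩)) K hK
    have hev := Metric.tendstoUniformlyOn_iff.1 hunif ε hε
    obtain ⟨ψ, hψ, hψs⟩ := hd.inter_nhds_nonempty hev
    exact ⟨ψ, ⟨ψ, hψ, rfl⟩, fun x hx => hψs x hx⟩

/-- Along a compact exhaustion `Kₙ`, take countable dense families of functions supported in `Kₙ`,
together with nonnegative `χₙ` equal to one on `Kₙ`. If `|φ - ψ| ≤ δ χₙ`, the statistics of `φ` and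
`ψ` differ by at most `δ` times that of `χₙ`, which is locally bounded; so every statistic is a
locally uniform limit of the chosen ones. -/
lemma Conf.exists_countable_iInf_induced [T2Space E] : ∃ D : Set C_c(E, ℝ), D.Countable ∧
    (instTopologicalSpaceConf : TopologicalSpace (Conf E)) =
      ⨅ φ ∈ D, TopologicalSpace.induced (Conf.sum φ) inferInstance := by
  let K : CompactExhaustion E := CompactExhaustion.choice E
  choose D hDc hDs hD using fun n => exists_countable_dense_of_isCompact (K.isCompact n)
  have hχ : ∀ n, ∃ χ : C_c(E, ℝ), (∀ x, 0 ≤ χ x) ∧ ∀ x ∈ K n, χ x = 1 := by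
    intro n
    obtain ⟨f, h1, -, hc, h01⟩ := exists_continuous_one_zero_of_isCompact (K.isCompact n)
      isClosed_empty (disjoint_empty _)
    exact ⟨⟨f, hc⟩, fun x => (h01 x).1, fun x hx => h1 hx⟩
  choose χ hχ0 hχ1 using hχ
  refine ⟨(⋃ n, D n) ∪ range χ, (countable_iUnion hDc).union (countable_range χ), ?_⟩
  refine le_antisymm (le_iInf₂ fun φ _ => iInf_le _ φ) ?_
  set t : TopologicalSpace (Conf E) := ⨅ φ ∈ (⋃ n, D n) ∪ range χ,
    TopologicalSpace.induced (Conf.sum φ) inferInstance with ht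
  refine le_iInf fun φ => continuous_iff_le_induced.1 ?_
  have hcont : ∀ ψ ∈ (⋃ n, D n) ∪ range χ, Continuous[t, _] (Conf.sum ψ) := fun ψ hψ =>
    continuous_iff_le_induced.2 (iInf₂_le ψ hψ)
  obtain ⟨n, hn⟩ := K.exists_superset_of_isCompact φ.hasCompactSupport
  have hχc := hcont (χ n) (Or.inr (mem_range_self n))
  rw [continuous_iff_continuousAt]
  intro X₀
  refine continuousAt_of_locally_uniform_approx_of_continuousAt fun u hu => ?_
  obtain ⟨ε, hε, hεu⟩ := Metric.mem_uniformity_dist.1 hu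
  have hnn : 0 ≤ Conf.sum (χ n) X₀ := finsum_nonneg fun x =>
    mul_nonneg (Nat.cast_nonneg _) (hχ0 n x)
  obtain ⟨δ, hδ, hδε⟩ : ∃ δ > 0, δ * (Conf.sum (χ n) X₀ + 1) < ε :=
    ⟨ε / (2 * (Conf.sum (χ n) X₀ + 1)), by positivity, by field_simp; linarith⟩
  obtain ⟨ψ, hψD, hψ⟩ := hD n φ hn δ hδ
  -- On this neighbourhood of `X₀` the weighted number of particles in `K n` is bounded, so a single
  -- `ψ` serves all of it.
  refine ⟨{X | Conf.sum (χ n) X < Conf.sum (χ n) X₀ + 1},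
    hχc.continuousAt.eventually (gt_mem_nhds (lt_add_one _)), Conf.sum ψ,
    (hcont ψ (Or.inl (mem_iUnion.2 ⟨n, hψD⟩))).continuousAt, fun X hX => hεu ?_⟩
  rw [Real.dist_eq]
  refine (Conf.abs_sum_sub_sum_le (χ := χ n) (c := δ) (fun x => ?_) X).trans_lt
    (lt_of_le_of_lt (mul_le_mul_of_nonneg_left hX.le hδ.le) hδε)
  by_cases hx : x ∈ K n
  · rw [hχ1 n x hx, mul_one]
    exact (hψ x hx).le
  · rw [image_eq_zero_of_notMem_tsupport fun h => hx (hn h),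
      image_eq_zero_of_notMem_tsupport fun h => hx (hDs n ψ hψD h), sub_zero, abs_zero]
    exact mul_nonneg hδ.le (hχ0 n x)

instance Conf.instSecondCountableTopology [T2Space E] :
    SecondCountableTopology (Conf E) := by
  obtain ⟨D, hD, hDt⟩ := Conf.exists_countable_iInf_induced (E := E)
  have : Countable D := hD.to_subtype
  rw [iInf_subtype'] at hDt
  rw [hDt]
  exact TopologicalSpace.secondCountableTopology_iInf fun φ =>
    TopologicalSpace.secondCountableTopology_induced _ _ _

end SecondCountable

/-! ### Weak convergence from finite-dimensional distributions -/

section WeakConvergence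

variable {Ω : Type*} [TopologicalSpace Ω] {ι : Type*}

/-- The joint map of finitely many real functions into Euclidean space. -/
def jointMap (Φ : ι → Ω → ℝ) (I : Finset ι) (x : Ω) : EuclideanSpace ℝ I :=
  WithLp.toLp 2 fun i => Φ i x

lemma continuous_jointMap {Φ : ι → Ω → ℝ} (hΦ : ∀ i, Continuous (Φ i)) (I : Finset ι) :
    Continuous (jointMap Φ I) :=
  (PiLp.continuous_toLp 2 _).comp (continuous_pi fun i => hΦ i)

/-- If the characteristic functions of the finite dimensional distributions of a family of
functions inducing the topology converge, then the probability measures converge weakly. -/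
theorem tendsto_of_tendsto_integral_exp [SecondCountableTopology Ω] [MeasurableSpace Ω]
    [BorelSpace Ω] {Φ : ι → Ω → ℝ}
    (hind : IsInducing fun (x : Ω) (i : ι) => Φ i x) {P' : ℕ → ProbabilityMeasure Ω}
    {P : ProbabilityMeasure Ω}
    (h : ∀ (I : Finset ι) (t : ι → ℝ), Tendsto
      (fun n => ∫ x, Complex.exp ((∑ i ∈ I, t i * Φ i x : ℝ) * Complex.I) ∂(P' n : Measure Ω))
      atTop (𝓝 (∫ x, Complex.exp ((∑ i ∈ I, t i * Φ i x : ℝ) * Complex.I) ∂(P : Measure Ω)))) :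
    Tendsto P' atTop (𝓝 P) := by
  classical
  have hΦ : ∀ i, Continuous (Φ i) := fun i => (continuous_apply i).comp hind.continuous
  have hJ := continuous_jointMap hΦ
  have hlaw : ∀ I : Finset ι,
      Tendsto (fun n => (P' n).map (hJ I).measurable.aemeasurable) atTop
        (𝓝 (P.map (hJ I).measurable.aemeasurable)) := by
    intro I
    refine ProbabilityMeasure.tendsto_of_tendsto_charFun fun t => ?_
    -- The vector `t` is extended by zero off `I`; the sum over `I` does not see the extension.
    have hchar : ∀ Q : ProbabilityMeasure Ω,
        charFun (Q.map (hJ I).measurable.aemeasurable : Measure (EuclideanSpace ℝ I)) t =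
        ∫ x, Complex.exp ((∑ i ∈ I, (if hi : i ∈ I then t ⟨i, hi⟩ else 0) * Φ i x : ℝ) *
          Complex.I) ∂(Q : Measure Ω) := by
      intro Q
      rw [charFun_apply, ProbabilityMeasure.toMeasure_map,
        integral_map (hJ I).measurable.aemeasurable
          (by fun_prop : Continuous _).aestronglyMeasurable]
      congr 1
      ext x
      congr 3
      rw [← Finset.sum_coe_sort I, PiLp.inner_apply]
      simp [jointMap]
    simp only [hchar]
    exact h I _
  have hopen : ∀ (I : Finset ι) (V : Set (EuclideanSpace ℝ I)), IsOpen V →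
      (P : Measure Ω) (jointMap Φ I ⁻¹' V) ≤
        liminf (fun n => (P' n : Measure Ω) (jointMap Φ I ⁻¹' V)) atTop := by
    intro I V hV
    have := ProbabilityMeasure.le_liminf_measure_open_of_tendsto (hlaw I) hV
    simpa only [ProbabilityMeasure.toMeasure_map,
      Measure.map_apply (hJ I).measurable hV.measurableSet] using this
  -- The open cylinders. They form a base closed under finite unions, because finitely many of them
  -- can be written over a common index set.
  let C : Set (Set Ω) := {U | ∃ (I : Finset ι) (V : Set (EuclideanSpace ℝ I)),
    IsOpen V ∧ jointMap Φ I ⁻¹' V = U}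
  have hCopen : ∀ U ∈ C, IsOpen U := by
    rintro _ ⟨I, V, hV, rfl⟩
    exact hV.preimage (hJ I)
  have hCmono : ∀ (I J : Finset ι) (V : Set (EuclideanSpace ℝ I)), IsOpen V → I ⊆ J →
      ∃ W : Set (EuclideanSpace ℝ J), IsOpen W ∧ jointMap Φ J ⁻¹' W = jointMap Φ I ⁻¹' V := by
    intro I J V hV hIJ
    refine ⟨(fun z : EuclideanSpace ℝ J =>
      (WithLp.toLp 2 fun i : I => z ⟨i, hIJ i.2⟩ : EuclideanSpace ℝ I)) ⁻¹' V,
      hV.preimage (by fun_prop), rfl⟩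
  have hCunion : ∀ F : Set (Set Ω), F.Finite → F ⊆ C → ⋃₀ F ∈ C := by
    intro F hF
    induction F, hF using Set.Finite.induction_on with
    | empty => exact fun _ => ⟨∅, ∅, isOpen_empty, by simp⟩
    | insert _ _ ih =>
      intro hsub
      obtain ⟨I, V, hV, hVU⟩ := ih ((subset_insert _ _).trans hsub)
      obtain ⟨J, W, hW, hWU⟩ := hsub (mem_insert _ _)
      obtain ⟨V', hV', hVV'⟩ := hCmono I (I ∪ J) V hV Finset.subset_union_left
      obtain ⟨W', hW', hWW'⟩ := hCmono J (I ∪ J) W hW Finset.subset_union_right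
      exact ⟨I ∪ J, W' ∪ V', hW'.union hV', by
        rw [preimage_union, hVV', hWW', hVU, hWU, sUnion_insert]⟩
  refine tendsto_of_forall_isOpen_le_liminf' fun G hG => ?_
  have hGC : ⋃₀ {U ∈ C | U ⊆ G} = G := by
    refine subset_antisymm (sUnion_subset fun U hU => hU.2) fun x hx => ?_
    obtain ⟨O, hO, rfl⟩ := hind.isOpen_iff.1 hG
    obtain ⟨I, u, hu, hsub⟩ := isOpen_pi_iff.1 hO _ hx
    refine ⟨jointMap Φ I ⁻¹' {z | ∀ i : I, z i ∈ u i}, ⟨⟨I, _, ?_, rfl⟩, ?_⟩, ?_⟩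
    · simp only [ofPred_forall]
      exact isOpen_iInter_of_finite fun i => (hu i i.2).1.preimage (by fun_prop)
    · exact fun y hy => hsub fun i hi => hy ⟨i, hi⟩
    · exact fun i => (hu i i.2).2
  -- Second countability enters here: countably many cylinders exhaust `G`, so by continuity from
  -- below `P G` is the supremum of `P` over their finite unions, which are again cylinders.
  obtain ⟨T, hTc, hTsub, hTG⟩ := TopologicalSpace.isOpen_sUnion_countable {U ∈ C | U ⊆ G}
    fun U hU => hCopen U hU.1
  have hunion : ⋃ F ∈ {F : Set (Set Ω) | F.Finite ∧ F ⊆ T}, ⋃₀ F = G := by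
    rw [← hGC, ← hTG]
    refine subset_antisymm (iUnion₂_subset fun F hF => sUnion_subset_sUnion hF.2) ?_
    rintro x ⟨U, hU, hx⟩
    exact mem_biUnion (x := {U}) ⟨finite_singleton U, singleton_subset_iff.2 hU⟩ ⟨U, rfl, hx⟩
  have hdir : DirectedOn ((· ⊆ ·) on fun F : Set (Set Ω) => ⋃₀ F)
      {F : Set (Set Ω) | F.Finite ∧ F ⊆ T} := fun F hF F' hF' =>
    ⟨F ∪ F', ⟨hF.1.union hF'.1, union_subset hF.2 hF'.2⟩,
      sUnion_subset_sUnion subset_union_left, sUnion_subset_sUnion subset_union_right⟩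
  rw [← hunion, measure_biUnion_eq_iSup (countable_ofPred_finite_subset hTc) hdir, hunion]
  refine iSup₂_le fun F hF => ?_
  obtain ⟨I, V, hV, hVU⟩ := hCunion F hF.1 fun U hU => (hTsub (hF.2 hU)).1
  rw [← hVU]
  refine (hopen I V hV).trans (liminf_le_liminf (Eventually.of_forall fun n => ?_))
  rw [hVU]
  exact measure_mono (sUnion_subset fun U hU => (hTsub (hF.2 hU)).2)

end WeakConvergence

/-! ### Convergence of determinantal measures -/

section Determinantal

variable {E : Type*} [TopologicalSpace E] [T2Space E] [LocallyCompactSpace E]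
    [SecondCountableTopology E] [MeasurableSpace E] [BorelSpace E] {μ : Measure E}

theorem TendstoLocTraceClass.tendsto_probabilityMeasure
    {K' : ℕ → Lp ℂ 2 μ →L[ℂ] Lp ℂ 2 μ} {K : Lp ℂ 2 μ →L[ℂ] Lp ℂ 2 μ}
    (h : TendstoLocTraceClass μ K' K) {P' : ℕ → ProbabilityMeasure (Conf E)}
    {P : ProbabilityMeasure (Conf E)} (hP' : ∀ n, IsDeterminantal μ (K' n) (P' n))
    (hP : IsDeterminantal μ K P) : Tendsto P' atTop (𝓝 P) := by
  -- An infimum of induced topologies is the topology induced by the joint map into the product.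
  refine tendsto_of_tendsto_integral_exp (Φ := fun φ : C_c(E, ℝ) => Conf.sum φ)
    (inducing_iInf_to_pi _) fun I t => ?_
  simp only [← Conf.sum_sum_smul]
  exact h.tendsto_integral_exp hP' hP _

end Determinantal

end DetProc

theorem proposition2p4 {E : Type*} [TopologicalSpace E] [T2Space E] [LocallyCompactSpace E]
    [SecondCountableTopology E] [MeasurableSpace E] [BorelSpace E]
    (μ : Measure E) [SigmaFinite μ]
    (L' : ℕ → ClosedSubmodule ℂ (Lp ℂ 2 μ)) (L : ClosedSubmodule ℂ (Lp ℂ 2 μ))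
    (m : ℕ) (v' : ℕ → Fin m → Lp ℂ 2 μ) (v : Fin m → Lp ℂ 2 μ)
    (hL : ∀ f : Lp ℂ 2 μ,
      Tendsto (fun n => (L' n).toSubmodule.starProjection f) atTop
        (𝓝 (L.toSubmodule.starProjection f)))
    (hv : ∀ i, Tendsto (fun n => v' n i) atTop (𝓝 (v i)))
    (hind : ∀ k, v k ∉ L.toSubmodule ⊔ Submodule.span ℂ (v '' Set.Iio k)) :
    (∀ f : Lp ℂ 2 μ,
      Tendsto (fun n => (DetProc.extend (L' n) (v' n)).toSubmodule.starProjection f) atTop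
        (𝓝 ((DetProc.extend L v).toSubmodule.starProjection f))) ∧
    (DetProc.TendstoLocTraceClass μ (fun n => (L' n).toSubmodule.starProjection)
        L.toSubmodule.starProjection →
      DetProc.TendstoLocTraceClass μ
        (fun n => (DetProc.extend (L' n) (v' n)).toSubmodule.starProjection)
        (DetProc.extend L v).toSubmodule.starProjection ∧
      ∀ (P' : ℕ → ProbabilityMeasure (DetProc.Conf E)) (P : ProbabilityMeasure (DetProc.Conf E)),
        (∀ n, DetProc.IsDeterminantal μ
          (DetProc.extend (L' n) (v' n)).toSubmodule.starProjection (P' n)) →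
        DetProc.IsDeterminantal μ (DetProc.extend L v).toSubmodule.starProjection P →
        Tendsto (fun n => (P' n).toFiniteMeasure) atTop (𝓝 P.toFiniteMeasure)) := by
  obtain ⟨hstrong, hloc⟩ := DetProc.tendsto_extend hL hv hind
  exact ⟨hstrong, fun h => ⟨hloc h, fun P' P hP' hP =>
    (ProbabilityMeasure.tendsto_nhds_iff_toFiniteMeasure_tendsto_nhds _).1
      ((hloc h).tendsto_probabilityMeasure hP' hP)⟩⟩
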